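/- Consider the following randomized CONGEST model. The network is a finite simple undirected graph $G=(V,E)$ with $n=|V|$ vertices (not necessarily connected), whose vertices are processors and whose edges are communication links. The processors have distinct IDs that are non-negative integers less than $n^k$ for a constant $k$; each processor initially knows $n$, $\varepsilon$, its ID, its degree (its links being numbered in an arbitrary order) and its own private, independent, fair coin tosses. Computation proceeds in synchronous rounds; in each round every processor performs arbitrary local computation and sends a message of $O(\log n)$ bits, possibly empty and possibly different, along each of its links. After the last round every processor outputs ACCEPT or REJECT. For $\varepsilon>0$, a graph $G=(V,E)$ is $\varepsilon$-far from a graph property $\mathcal P$ (general graph model) if $G$ does not have $\mathcal P$ and every graph on $V$ that has $\mathcal P$ differs from $G$ in at least $\varepsilon|E|$ edges (added or removed). A one-sided $\varepsilon$-tester for $\mathcal P$ is an algorithm in this model such that (i) if $G$ has $\mathcal P$, then, for every outcome of the coin tosses, all processors output ACCEPT; (ii) if $G$ is $\varepsilon$-far from $\mathcal P$, then with probability at least $2/3$ at least one processor outputs REJECT. Corollary. For each of the two properties "bipartite" and "cycle-free (acyclic)" there is a constant $C$ such that for every $k$ there is a constant $c$ such that, for every $\varepsilon>0$, there is a one-sided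 $\varepsilon$-tester for the property in the randomized CONGEST model which, on every network with $n$ processors and distinct IDs less than $n^k$, uses at most $C\cdot(\log n)/\varepsilon$ rounds and messages of at most $c\log n$ bits. -/

import Mathlib

universe u

namespace Congest

/-- A network on the graph `G`: every processor has a distinct ID, and the links at `v` are
numbered by the ports `0, …, deg v - 1` in an arbitrary order. -/
structure Network {V : Type u} (G : SimpleGraph V) where
  id : V → ℕ
  id_injective : Function.Injective id
  deg : V → ℕ
  port : ∀ v, Fin (deg v) ≃ G.neighborSet v

/-- A message of at most `B` bits. -/
abbrev Message (B : ℕ) : Type := {l : List Bool // l.length ≤ B}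

/-- The empty message. -/
def Message.empty (B : ℕ) : Message B := ⟨[], Nat.zero_le B⟩

/-- A randomized CONGEST program, executed by every processor. A processor starts knowing only its
ID, its degree and its private coin tosses. In each round it sends, through each of its ports, a
message of at most `bandwidth` bits (depending on the port), and then updates its state from the
messages received, indexed by port. After `rounds` rounds it outputs `true` (ACCEPT) or
`false` (REJECT). Local computation is unrestricted. -/
structure Program where
  bandwidth : ℕ
  rounds : ℕ
  coins : ℕ
  State : Type
  init : (id deg : ℕ) → (Fin coins → Bool) → State
  send : State → (port : ℕ) → Message bandwidth
  receive : State → (inbox : ℕ → Message bandwidth) → State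
  output : State → Bool

/-- Outcomes of the private coin tosses of all processors. -/
abbrev Program.Coins (A : Program) (V : Type u) : Type u := V → Fin A.coins → Bool

/-- The messages that `v` receives, by port, when each processor `u` sends `out u q` through its
port `q`: at port `p`, leading to the neighbor `u`, `v` receives what `u` sends through the
port of `u` that leads to `v`. -/
def inbox {V : Type u} {G : SimpleGraph V} (N : Network G) {B : ℕ} (out : V → ℕ → Message B)
    (v : V) (p : ℕ) : Message B :=
  if h : p < N.deg v then
    out (N.port v ⟨p, h⟩)
      ((N.port (N.port v ⟨p, h⟩)).symm ⟨v, (N.port v ⟨p, h⟩).2.symm⟩)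
  else Message.empty B

/-- The state of each processor after `t` synchronous rounds. -/
def Program.run (A : Program) {V : Type u} {G : SimpleGraph V} (N : Network G)
    (ω : A.Coins V) : ℕ → V → A.State
  | 0 => fun v => A.init (N.id v) (N.deg v) (ω v)
  | t + 1 => fun v =>
      A.receive (A.run N ω t v) (inbox N (fun u => A.send (A.run N ω t u)) v)

/-- The output of the processor `v`; `true` means ACCEPT. -/
def Program.result (A : Program) {V : Type u} {G : SimpleGraph V} (N : Network G)
    (ω : A.Coins V) (v : V) : Bool :=
  A.output (A.run N ω A.rounds v)

/-- The probability of an event when all coin tosses are fair and independent. -/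
noncomputable def Program.prob (A : Program) {V : Type u} (S : Set (A.Coins V)) : ℝ :=
  (S.ncard : ℝ) / (Nat.card (A.Coins V) : ℝ)

/-- `G` is `ε`-far (in the general graph model) from the property `P`: it lacks `P`, and at least
`ε * |E(G)|` edges must be added or removed to obtain `P`. The first clause matters only for
graphs without edges. -/
def IsFar {V : Type u} (P : SimpleGraph V → Prop) (ε : ℝ) (G : SimpleGraph V) : Prop :=
  ¬ P G ∧ ∀ H : SimpleGraph V, P H →
    ε * (G.edgeSet.ncard : ℝ) ≤ ((symmDiff G.edgeSet H.edgeSet).ncard : ℝ)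

/-- `A n` being the program for networks with `n` processors, `A` is a one-sided `ε`-tester for `P`
on networks whose IDs are smaller than `n ^ k`. -/
def IsOneSidedTester (P : ∀ V : Type u, SimpleGraph V → Prop) (k : ℕ) (ε : ℝ)
    (A : ℕ → Program) : Prop :=
  ∀ (V : Type u) [Fintype V] (G : SimpleGraph V) (N : Network G),
    (∀ v, N.id v < Fintype.card V ^ k) →
      (P V G → ∀ (ω : (A (Fintype.card V)).Coins V) (v : V),
        (A (Fintype.card V)).result N ω v = true) ∧
      (IsFar (P V) ε G →
        2 / 3 ≤ (A (Fintype.card V)).prob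
          {ω : (A (Fintype.card V)).Coins V | ∃ v, (A (Fintype.card V)).result N ω v = false})

/-- For every `ε > 0` there is a one-sided `ε`-tester for `P` in the randomized CONGEST model that
takes `O((log n) / ε)` rounds. The constant `C` of the round complexity is absolute; the constant
`c` of the message length may depend on the exponent `k` that bounds the IDs. -/
def HasLogTester (P : ∀ V : Type u, SimpleGraph V → Prop) : Prop :=
  ∃ C : ℝ, ∀ k : ℕ, ∃ c : ℝ, ∀ ε : ℝ, 0 < ε →
    ∃ A : ℕ → Program,
      (∀ n : ℕ, ((A n).bandwidth : ℝ) ≤ c * Real.log n) ∧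
      (∀ n : ℕ, ((A n).rounds : ℝ) ≤ C * (Real.log n / ε)) ∧
      IsOneSidedTester P k ε A

end Congest

/-! Every processor draws a strength that has a truncated geometric distribution, and a processor
`v` joins the cluster of the processor `w` that maximizes `strength w - dist v w`, ties being
broken by IDs. Flooding finds `w` and `dist v w`, because the remaining strength drops by one in
each hop. The geometric distribution is memoryless: given that a candidate has the highest score,
it still has it with probability almost `q` after its strength is lowered by one. As the distances
from the two ends of an edge differ by at most one, a candidate that leads by such a margin is the
center of both ends, so each edge is cut with probability little more than `1 - q`, which is
`O(ε)`.

Within a cluster, the distance from the center certifies the property: parities of the distances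
are a two-coloring of a bipartite graph, and in a forest every vertex has at most one neighbor
closer to the center and none at the same distance. If all processors accept, then the graph
without the cut edges has the property, so a graph that is `ε`-far from it has at least `ε |E|` cut
edges; by Markov's inequality this is unlikely.
-/

namespace Congest

open Finset
open scoped BigOperators

theorem exists_message_encoding {T : Type*} [Nonempty T] {S : Finset T} {B : ℕ}
    (hS : #S ≤ 2 ^ B) :
    ∃ (encode : T → Message B) (decode : Message B → T), Set.LeftInvOn decode encode S := by
  classical
  obtain ⟨code⟩ : Nonempty (S ↪ (Fin B → Bool)) :=
    Function.Embedding.nonempty_of_card_le (by simpa using hS)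
  let encode (x : T) : Message B :=
    if h : x ∈ S then ⟨List.ofFn (code ⟨x, h⟩), by simp⟩ else Message.empty B
  have injOn_encode : Set.InjOn encode S := fun x hx y hy hxy => by
    rw [mem_coe] at hx hy
    simp only [encode, dif_pos hx, dif_pos hy, Subtype.mk.injEq] at hxy
    simpa using code.injective (List.ofFn_injective hxy)
  exact ⟨encode, Function.invFunOn encode S, injOn_encode.leftInvOn_invFunOn⟩

section Flooding

variable {V : Type u} {G : SimpleGraph V} (N : Network G) {T : Type} [LinearOrder T]
  (step : T → T) (start : V → T)

/-- The token held by each processor after `t` rounds of flooding: in every round a processor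
receives from each neighbor the token held there, changed by `step`, and keeps the largest. -/
def Network.flood : ℕ → V → T
  | 0 => start
  | t + 1 => fun v =>
      univ.fold max (flood t v) fun p : Fin (N.deg v) => step (flood t (N.port v p))

variable {N step start}

theorem Network.exists_port {u v : V} (h : G.Adj v u) : ∃ p, (N.port v p : V) = u :=
  ⟨(N.port v).symm ⟨u, h⟩, by simp⟩

theorem Network.flood_succ_le {t : ℕ} {v : V} {x : T} :
    N.flood step start (t + 1) v ≤ x ↔
      N.flood step start t v ≤ x ∧ ∀ u, G.Adj v u → step (N.flood step start t u) ≤ x := by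
  rw [flood, fold_max_le]
  refine and_congr_right' ⟨fun h u hu => ?_, fun h p _ => h _ (N.port v p).2⟩
  obtain ⟨p, rfl⟩ := exists_port (N := N) hu
  exact h p (mem_univ p)

theorem Network.le_flood_succ {t : ℕ} {v : V} {x : T} :
    x ≤ N.flood step start (t + 1) v ↔
      x ≤ N.flood step start t v ∨ ∃ u, G.Adj v u ∧ x ≤ step (N.flood step start t u) := by
  rw [flood, le_fold_max]
  refine or_congr_right ⟨fun ⟨p, _, h⟩ => ⟨_, (N.port v p).2, h⟩, fun ⟨u, hu, h⟩ => ?_⟩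
  obtain ⟨p, rfl⟩ := exists_port (N := N) hu
  exact ⟨p, mem_univ p, h⟩

theorem Network.isGreatest_flood (hstep : Monotone step) (t : ℕ) (v : V) :
    IsGreatest {x | ∃ w, ∃ q : G.Walk v w, q.length ≤ t ∧ step^[q.length] (start w) = x}
      (N.flood step start t v) := by
  induction t generalizing v with
  | zero =>
    refine ⟨⟨v, .nil, le_rfl, rfl⟩, ?_⟩
    rintro _ ⟨w, q, hq, rfl⟩
    obtain rfl := SimpleGraph.Walk.eq_of_length_eq_zero (Nat.le_zero.1 hq)
    rw [Nat.le_zero.1 hq]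
    rfl
  | succ t ih =>
    obtain ⟨hv, hadj⟩ := flood_succ_le.1 (le_refl (N.flood step start (t + 1) v))
    constructor
    · rcases le_flood_succ.1 (le_refl (N.flood step start (t + 1) v)) with hle | ⟨u, hu, hle⟩
      · obtain ⟨w, q, hq, hx⟩ := (ih v).1
        exact ⟨w, q, hq.trans t.le_succ, hx.trans (hv.antisymm hle)⟩
      · obtain ⟨w, q, hq, hx⟩ := (ih u).1
        refine ⟨w, .cons hu q, Nat.succ_le_succ hq, ?_⟩
        rw [SimpleGraph.Walk.length_cons, Function.iterate_succ_apply', hx]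
        exact (hadj u hu).antisymm hle
    · rintro _ ⟨w, q, hq, rfl⟩
      cases q with
      | nil => exact ((ih v).2 ⟨v, .nil, t.zero_le, rfl⟩).trans hv
      | cons hu q =>
        rw [SimpleGraph.Walk.length_cons, Function.iterate_succ_apply']
        exact (hstep ((ih _).2 ⟨w, q, Nat.le_of_succ_le_succ hq, rfl⟩)).trans (hadj _ hu)

end Flooding

section Gossip

theorem apply_inbox_port {V : Type u} {G : SimpleGraph V} (N : Network G) {T : Type*} {B : ℕ}
    {out : V → ℕ → Message B} {f : Message B → T} {x : V → T} (h : ∀ u p, f (out u p) = x u)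
    (v : V) (p : Fin (N.deg v)) : f (inbox N out v p) = x (N.port v p) :=
  (congrArg f (dif_pos p.2)).trans (h _ _)

/-- The state of a processor that runs `gossipProgram`. -/
structure GossipState (T : Type) where
  deg : ℕ
  token : T
  verdict : Bool

open Classical in
/-- The program that floods for `R` rounds and then, in one more round, compares the token reached
at a processor with those of its neighbors: a processor accepts if they satisfy `check`. The coins
of a processor determine its token at the start. -/
noncomputable def gossipProgram {T : Type} [LinearOrder T] {B : ℕ} (encode : T → Message B)
    (decode : Message B → T) (step : T → T) {m : ℕ} (start : ℕ → (Fin m → Bool) → T)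
    (check : ∀ d, T → (Fin d → T) → Prop) (R : ℕ) : Program where
  bandwidth := B
  rounds := R + 1
  coins := m
  State := GossipState T
  init id deg c := ⟨deg, start id c, true⟩
  send s _ := encode s.token
  receive s inbox :=
    { deg := s.deg
      token := univ.fold max s.token fun p : Fin s.deg => step (decode (inbox p))
      verdict := decide (check s.deg s.token fun p => decode (inbox p)) }
  output s := s.verdict

variable {V : Type u} {G : SimpleGraph V} (N : Network G) {T : Type} [LinearOrder T] {B m : ℕ}
  {encode : T → Message B} {decode : Message B → T} {step : T → T}
  {start : ℕ → (Fin m → Bool) → T} {check : ∀ d, T → (Fin d → T) → Prop} {R : ℕ}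
  {ω : V → Fin m → Bool}

open Classical in
theorem gossipProgram_receive (s : GossipState T) (mail : ℕ → Message B) {x : Fin s.deg → T}
    (h : ∀ p : Fin s.deg, decode (mail p) = x p) :
    (gossipProgram encode decode step start check R).receive s mail =
      ⟨s.deg, univ.fold max s.token fun p => step (x p), decide (check s.deg s.token x)⟩ := by
  obtain rfl : (fun p : Fin s.deg => decode (mail p)) = x := funext h
  rfl

/-- The tokens of the processors after `t` rounds of `gossipProgram` with the coin tosses `ω`. -/
abbrev gossipTokens (step : T → T) (start : ℕ → (Fin m → Bool) → T) (ω : V → Fin m → Bool)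
    (t : ℕ) : V → T :=
  N.flood step (fun v => start (N.id v) (ω v)) t

open Classical in
theorem gossipProgram_run_succ {t : ℕ}
    (hdecode : ∀ v, decode (encode (gossipTokens N step start ω t v)) =
      gossipTokens N step start ω t v)
    (h : ∀ v, ∃ b, (gossipProgram encode decode step start check R).run N ω t v =
      ⟨N.deg v, gossipTokens N step start ω t v, b⟩) (v : V) :
    (gossipProgram encode decode step start check R).run N ω (t + 1) v =
      ⟨N.deg v, gossipTokens N step start ω (t + 1) v,
        decide (check (N.deg v) (gossipTokens N step start ω t v)
          fun p => gossipTokens N step start ω t (N.port v p))⟩ := by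
  choose b hb using h
  have decode_inbox := apply_inbox_port N (f := decode)
    (x := gossipTokens N step start ω t) (out := fun u _ => encode
      ((gossipProgram encode decode step start check R).run N ω t u : GossipState T).token)
    (fun u _ => by rw [hb u]; exact hdecode u) v
  exact (congrArg (fun s => (gossipProgram encode decode step start check R).receive s _)
    (hb v)).trans (gossipProgram_receive _ _ decode_inbox)

theorem gossipProgram_run
    (hdecode : ∀ t v, decode (encode (gossipTokens N step start ω t v)) =
      gossipTokens N step start ω t v) (t : ℕ) (v : V) :
    ∃ b, (gossipProgram encode decode step start check R).run N ω t v =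
      ⟨N.deg v, gossipTokens N step start ω t v, b⟩ := by
  induction t generalizing v with
  | zero => exact ⟨true, rfl⟩
  | succ t ih => exact ⟨_, gossipProgram_run_succ N (hdecode t) ih v⟩

theorem gossipProgram_result_eq_true_iff
    (hdecode : ∀ t v, decode (encode (gossipTokens N step start ω t v)) =
      gossipTokens N step start ω t v) (v : V) :
    (gossipProgram encode decode step start check R).result N ω v = true ↔
      check (N.deg v) (gossipTokens N step start ω R v)
        fun p => gossipTokens N step start ω R (N.port v p) := by
  classical
  have h := congrArg GossipState.verdict
    (gossipProgram_run_succ (check := check) (R := R) N (hdecode R)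
      (gossipProgram_run N hdecode R) v)
  exact (Bool.eq_iff_iff.1 h).trans decide_eq_true_iff

end Gossip

section Leads

variable {ι α : Type*} [LinearOrder α] {s : Set ι} {id : ι → α} {a b : ι → ℤ} {w w' : ι}

/-- `w` is the candidate in `s` with the highest score `a`, ties being broken in favor of the
larger `id`. -/
def Leads (s : Set ι) (id : ι → α) (a : ι → ℤ) (w : ι) : Prop :=
  w ∈ s ∧ IsMaxOn (fun x => toLex (a x, id x)) s w

theorem Leads.eq (hid : id.Injective) (h : Leads s id a w) (h' : Leads s id a w') : w = w' :=
  hid (congrArg (fun x : ℤ ×ₗ α => (ofLex x).2) ((h'.2 h.1).antisymm (h.2 h'.1)))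

theorem Leads.mono (h : Leads s id a w) (hw : a w ≤ b w) (hs : ∀ x ∈ s, x ≠ w → b x ≤ a x) :
    Leads s id b w := by
  refine ⟨h.1, fun x hx => ?_⟩
  obtain rfl | hxw := eq_or_ne x w
  · exact le_refl (toLex (b x, id x))
  · calc toLex (b x, id x) ≤ toLex (a x, id x) := Prod.Lex.toLex_mono ⟨hs x hx hxw, le_rfl⟩
      _ ≤ toLex (a w, id w) := h.2 hx
      _ ≤ toLex (b w, id w) := Prod.Lex.toLex_mono ⟨hw, le_rfl⟩

theorem exists_leads (hs : s.Finite) (hne : s.Nonempty) (id : ι → α) (a : ι → ℤ) :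
    ∃ w, Leads s id a w :=
  Set.exists_max_image s (fun x => toLex (a x, id x)) hs hne

end Leads

section Centers

variable {V : Type u} {G : SimpleGraph V} {α : Type*} [LinearOrder α] {id : V → α} {ρ : V → ℕ}

/-- `w` is the center of the cluster of `v`: when the vertices have strengths `ρ`, it is the vertex
whose strength exceeds its distance from `v` by most. -/
def IsCenter (G : SimpleGraph V) (id : V → α) (ρ : V → ℕ) (v w : V) : Prop :=
  Leads {x | G.Reachable v x} id (fun x => ρ x - G.dist v x) w

open Classical in
theorem isCenter_of_leads_update {a : V → ℤ} {v w : V}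
    (ha : ∀ x, (ρ x : ℤ) - G.dist v x ≤ a x ∧ a x - 1 ≤ ρ x - G.dist v x)
    (h : Leads {x | G.Reachable v x} id (Function.update a w (a w - 1)) w) :
    IsCenter G id ρ v w :=
  h.mono (by simpa using (ha w).2) fun x _ hx => by simpa [hx] using (ha x).1

/-- The score of a candidate center as seen from an edge `uv`, that is, from the nearer end. -/
noncomputable def edgeScore (G : SimpleGraph V) (ρ : V → ℕ) (u v x : V) : ℤ :=
  ρ x - (min (G.dist u x) (G.dist v x) : ℕ)

theorem edgeScore_comm (u v : V) : edgeScore G ρ u v = edgeScore G ρ v u := by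
  ext x
  rw [edgeScore, edgeScore, min_comm]

theorem edgeScore_bounds {u v : V} (h : G.Adj u v) (x : V) :
    (ρ x : ℤ) - G.dist u x ≤ edgeScore G ρ u v x ∧
      edgeScore G ρ u v x - 1 ≤ ρ x - G.dist u x := by
  have := h.diff_dist_adj (u := x)
  rw [edgeScore, G.dist_comm (u := u), G.dist_comm (u := v)]
  omega

open Classical in
/-- Distances from the two ends of an edge differ by at most one, so a candidate that leads by more
than one seen from the edge leads at both ends. -/
theorem isCenter_of_adj {u v w : V} (h : G.Adj u v)
    (hw : Leads {x | G.Reachable u x} id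
      (Function.update (edgeScore G ρ u v) w (edgeScore G ρ u v w - 1)) w) :
    IsCenter G id ρ u w ∧ IsCenter G id ρ v w := by
  have reachable_iff : {x | G.Reachable u x} = {x | G.Reachable v x} :=
    Set.ext fun x => ⟨h.symm.reachable.trans, h.reachable.trans⟩
  refine ⟨isCenter_of_leads_update (edgeScore_bounds h) hw, ?_⟩
  rw [reachable_iff, edgeScore_comm] at hw
  exact isCenter_of_leads_update (edgeScore_bounds h.symm) hw

end Centers

section Tokens

/-- A token, ordered lexicographically: the remaining strength of its origin, the ID of its origin,
and the number of hops made. Negative strengths are allowed, so that a token is never dropped. -/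
abbrev Token : Type := (ℤ ×ₗ ℕ) ×ₗ ℕ

/-- The token with remaining strength `m`, from the origin with ID `i`, after `h` hops. -/
def token (m : ℤ) (i h : ℕ) : Token := toLex (toLex (m, i), h)

/-- The effect of one hop on a token. -/
def hop (x : Token) : Token :=
  token ((ofLex (ofLex x).1).1 - 1) (ofLex (ofLex x).1).2 ((ofLex x).2 + 1)

/-- The ID of the origin of a token and the number of hops made, which name a cluster and the depth
in it. -/
def label (x : Token) : ℕ × ℕ := ((ofLex (ofLex x).1).2, (ofLex x).2)

/-- All tokens with strength and hops at most `R` from origins with ID less than `K`. -/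
def tokens (K R : ℕ) : Finset Token :=
  (range (R + 1) ×ˢ range K ×ˢ range (R + 1)).image fun x => token x.1 x.2.1 x.2.2

theorem card_tokens_le (K R : ℕ) : #(tokens K R) ≤ K * (R + 1) ^ 2 := by
  refine card_image_le.trans_eq ?_
  simp only [card_product, card_range]
  ring

theorem toLex_le_of_token_le {m m' : ℤ} {i i' h h' : ℕ} (hle : token m i h ≤ token m' i' h') :
    toLex (m, i) ≤ toLex (m', i') :=
  Prod.Lex.monotone_fst _ _ hle

theorem le_of_token_le {m m' : ℤ} {i i' h h' : ℕ} (hle : token m i h ≤ token m' i' h') : m ≤ m' :=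
  Prod.Lex.monotone_fst _ _ (toLex_le_of_token_le hle)

theorem hop_monotone : Monotone hop := by
  intro x y hxy
  simp only [hop, token, Prod.Lex.le_iff, Prod.Lex.lt_iff, ofLex_toLex,
    EmbeddingLike.apply_eq_iff_eq, Prod.mk.injEq] at hxy ⊢
  rcases hxy with h | ⟨h, h'⟩
  · omega
  · rw [h]
    omega

theorem hop_iterate_token (m : ℤ) (i h n : ℕ) :
    hop^[n] (token m i h) = token (m - n) i (h + n) := by
  induction n with
  | zero => simp
  | succ n ih =>
    rw [Function.iterate_succ_apply', ih]
    simp only [hop, token, ofLex_toLex]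
    push_cast
    rw [sub_sub, add_assoc]

variable {V : Type u} {G : SimpleGraph V} (N : Network G) {K R t : ℕ} {ρ : V → ℕ} {v w : V}

theorem token_le_flood (h : G.Reachable v w) (hd : G.dist v w ≤ t) :
    token (ρ w - G.dist v w) (N.id w) (G.dist v w) ≤
      N.flood hop (fun v => token (ρ v) (N.id v) 0) t v := by
  obtain ⟨q, hq⟩ := h.exists_walk_length_eq_dist
  refine (N.isGreatest_flood hop_monotone t v).2 ⟨w, q, hq.trans_le hd, ?_⟩
  rw [hop_iterate_token, hq, zero_add]

theorem flood_hop_eq (ρ : V → ℕ) (t : ℕ) (v : V) :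
    ∃ w, G.Reachable v w ∧ N.flood hop (fun v => token (ρ v) (N.id v) 0) t v =
      token (ρ w - G.dist v w) (N.id w) (G.dist v w) := by
  obtain ⟨w, q, hq, hflood⟩ :=
    (N.isGreatest_flood hop_monotone (start := fun v => token (ρ v) (N.id v) 0) t v).1
  rw [hop_iterate_token, zero_add] at hflood
  have dist_le := SimpleGraph.dist_le q
  have length_le := le_of_token_le
    ((token_le_flood N q.reachable (dist_le.trans hq)).trans_eq hflood.symm)
  have length_eq : q.length = G.dist v w := by omega
  exact ⟨w, q.reachable, by rw [← hflood, length_eq]⟩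

theorem le_of_flood_eq {m : ℤ} {i h : ℕ}
    (hf : N.flood hop (fun v => token (ρ v) (N.id v) 0) t v = token m i h) : (ρ v : ℤ) ≤ m := by
  have := token_le_flood N (ρ := ρ) (t := t) (SimpleGraph.Reachable.refl v) (by simp)
  rw [hf] at this
  simpa using le_of_token_le this

theorem flood_mem_tokens (hρ : ∀ v, ρ v ≤ R) (hid : ∀ v, N.id v < K) (t : ℕ) (v : V) :
    N.flood hop (fun v => token (ρ v) (N.id v) 0) t v ∈ tokens K R := by
  obtain ⟨w, -, hw⟩ := flood_hop_eq N ρ t v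
  have := le_of_flood_eq N hw
  have := hρ w
  refine mem_image.2 ⟨(ρ w - G.dist v w, N.id w, G.dist v w), ?_, ?_⟩
  · simp only [mem_product, mem_range, hid, true_and]
    omega
  · rw [hw, Nat.cast_sub (by omega)]

/-- The ID of the center of the cluster of `v` and the depth of `v` in this cluster, as found by
flooding for `R` rounds with the strengths `ρ`. -/
def clusterLabel (R : ℕ) (ρ : V → ℕ) (v : V) : ℕ × ℕ :=
  label (N.flood hop (fun v => token (ρ v) (N.id v) 0) R v)

theorem exists_isCenter (hρ : ∀ v, ρ v ≤ R) (v : V) :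
    ∃ w, IsCenter G N.id ρ v w ∧ clusterLabel N R ρ v = (N.id w, G.dist v w) := by
  obtain ⟨w, hvw, hw⟩ := flood_hop_eq N ρ R v
  refine ⟨w, ⟨hvw, fun x hx => ?_⟩, by rw [clusterLabel, hw]; rfl⟩
  rcases le_or_gt (G.dist v x) R with hd | hd
  · exact toLex_le_of_token_le (hw ▸ token_le_flood N hx hd)
  · have score_lt : (ρ x : ℤ) - G.dist v x < ρ w - G.dist v w := by
      have := le_of_flood_eq N hw
      have := hρ x
      omega
    exact Prod.Lex.toLex_le_toLex.2 (.inl score_lt)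

theorem clusterLabel_eq (hρ : ∀ v, ρ v ≤ R) (h : IsCenter G N.id ρ v w) :
    clusterLabel N R ρ v = (N.id w, G.dist v w) := by
  obtain ⟨w', hw', heq⟩ := exists_isCenter N hρ v
  rwa [h.eq N.id_injective hw']

end Tokens

section Certificates

variable {V : Type u} {G : SimpleGraph V} {u v w : V}

/-- The subgraph of the edges whose ends belong to the same cluster, clusters being the fibers of
`a`. -/
def clusterGraph {α : Type*} (G : SimpleGraph V) (a : V → α) : SimpleGraph V where
  Adj u v := G.Adj u v ∧ a u = a v
  symm := ⟨fun _ _ h => ⟨h.1.symm, h.2.symm⟩⟩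

theorem clusterGraph_le {α : Type*} (a : V → α) : clusterGraph G a ≤ G := fun _ _ h => h.1

/-- A condition on the degree of a processor, its label (cluster ID and depth in the cluster) and
the labels of its neighbors. -/
abbrev LocalCheck : Type := ∀ d : ℕ, ℕ × ℕ → (Fin d → ℕ × ℕ) → Prop

/-- The condition `ok` holds at the processor `v` when the labels are `ℓ`. -/
def Network.Passes (N : Network G) (ok : LocalCheck) (ℓ : V → ℕ × ℕ) (v : V) : Prop :=
  ok (N.deg v) (ℓ v) fun p => ℓ (N.port v p)

/-- The condition `ok` certifies `P`: if the graph has `P`, it holds when the vertices are labelled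
by the centers of their clusters and the distances from them; conversely, whatever the labels, if
it holds everywhere then the clusters have `P`. Edgeless graphs have `P`, so that a graph lacking
`P` has an edge to be cut. -/
structure IsCertificate (P : ∀ V : Type u, SimpleGraph V → Prop) (ok : LocalCheck) : Prop where
  bot : ∀ V, P V ⊥
  sound : ∀ {V : Type u} {G : SimpleGraph V} (N : Network G) {center : V → V}, P V G →
    (∀ v, G.Reachable v (center v)) →
      ∀ v, N.Passes ok (fun v => (N.id (center v), G.dist v (center v))) v
  complete : ∀ {V : Type u} {G : SimpleGraph V} (N : Network G) {ℓ : V → ℕ × ℕ},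
    (∀ v, N.Passes ok ℓ v) → P V (clusterGraph G fun v => (ℓ v).1)

/-- In a cluster, the depths of adjacent processors have different parities. -/
def bipartiteCheck : LocalCheck := fun d x y =>
  ∀ p : Fin d, (y p).1 = x.1 → (Even (y p).2 ↔ ¬Even x.2)

/-- In a cluster, the depths of adjacent processors differ, and at most one neighbor has a smaller
depth. -/
def acyclicCheck : LocalCheck := fun d x y =>
  (∀ p : Fin d, (y p).1 = x.1 → (y p).2 ≠ x.2) ∧ {p | (y p).1 = x.1 ∧ (y p).2 < x.2}.Subsingleton

theorem even_dist_iff_of_adj (hG : G.IsBipartite) (h : G.Adj v u) (hv : G.Reachable v w) :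
    Even (G.dist u w) ↔ ¬Even (G.dist v w) := by
  obtain ⟨q, hq⟩ := hv.exists_walk_length_eq_dist
  obtain ⟨q', hq'⟩ := (h.symm.reachable.trans hv).exists_walk_length_eq_dist
  let color : G.Coloring Bool := G.recolorOfEquiv finTwoEquiv hG.some
  have color_ne := color.valid h
  rw [← hq, ← hq', color.even_length_iff_congr, color.even_length_iff_congr]
  grind

theorem isCertificate_bipartiteCheck :
    IsCertificate.{u} (fun _ G => G.IsBipartite) bipartiteCheck where
  bot _ := SimpleGraph.isAcyclic_bot.isBipartite
  sound {V G} N center hG hcenter v p hid := by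
    have heq := N.id_injective hid
    dsimp only
    rw [heq]
    exact even_dist_iff_of_adj hG (N.port v p).2 (hcenter v)
  complete {V G} N ℓ h := by
    refine ⟨SimpleGraph.recolorOfEquiv _ finTwoEquiv.symm
      ⟨fun v => decide (Even (ℓ v).2), fun {v u} huv heq => ?_⟩⟩
    obtain ⟨p, rfl⟩ := N.exists_port huv.1
    have := h v p huv.2.symm
    dsimp only at this
    rw [decide_eq_decide] at heq
    tauto

/-- The vertex of largest depth on a cycle would have two neighbors of smaller depth. -/
theorem isAcyclic_of_depth {α : Type*} [LinearOrder α] (depth : V → α)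
    (hne : ∀ v u, G.Adj v u → depth u ≠ depth v)
    (hlow : ∀ v, {u | G.Adj v u ∧ depth u < depth v}.Subsingleton) : G.IsAcyclic := by
  classical
  intro v c hc
  obtain ⟨w, hw, hmax⟩ := exists_max_image c.support.toFinset depth ⟨v, by simp⟩
  rw [List.mem_toFinset] at hw
  have hc' := hc.rotate hw
  have depth_lt (u) (hu : u ∈ (c.rotate w hw).support) (hadj : G.Adj w u) : depth u < depth w :=
    (hmax u (by rwa [List.mem_toFinset, ← c.mem_support_rotate_iff w hw])).lt_of_ne (hne w u hadj)
  have adj_snd := SimpleGraph.Walk.adj_snd hc'.not_nil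
  have adj_penultimate := (SimpleGraph.Walk.adj_penultimate hc'.not_nil).symm
  exact hc'.snd_ne_penultimate <| hlow w
    ⟨adj_snd, depth_lt _ (SimpleGraph.Walk.getVert_mem_support _ _) adj_snd⟩
    ⟨adj_penultimate, depth_lt _ (SimpleGraph.Walk.getVert_mem_support _ _) adj_penultimate⟩

theorem eq_penultimate_of_dist_lt (hG : G.IsAcyclic) {p : G.Walk w v} (hp : p.IsPath)
    (h : G.Adj v u) (hu : G.dist w u < G.dist w v) : u = p.penultimate := by
  classical
  refine hG.eq_penultimate_of_adj_end hp h ?_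
  obtain ⟨q, hq, hql⟩ := (p.reachable.trans h.reachable).exists_path_of_dist
  refine hG.mem_support_of_ne_mem_support_of_adj_of_isPath hp hq h fun hv => hu.not_ge ?_
  calc G.dist w v ≤ (q.takeUntil v hv).length := SimpleGraph.dist_le _
    _ ≤ q.length := q.length_takeUntil_le_length hv
    _ = G.dist w u := hql

theorem subsingleton_adj_dist_lt (hG : G.IsAcyclic) (hv : G.Reachable w v) :
    {u | G.Adj v u ∧ G.dist w u < G.dist w v}.Subsingleton := by
  obtain ⟨p, hp, -⟩ := hv.exists_path_of_dist
  intro u hu u' hu'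
  rw [eq_penultimate_of_dist_lt hG hp hu.1 hu.2, eq_penultimate_of_dist_lt hG hp hu'.1 hu'.2]

theorem isCertificate_acyclicCheck :
    IsCertificate.{u} (fun _ G => G.IsAcyclic) acyclicCheck where
  bot _ := SimpleGraph.isAcyclic_bot
  sound {V G} N center hG hcenter v := by
    refine ⟨fun p hid => ?_, fun p hp p' hp' => (N.port v).injective (Subtype.ext ?_)⟩
    · dsimp only
      rw [N.id_injective hid, G.dist_comm, G.dist_comm (u := v)]
      exact (hG.dist_ne_of_adj (N.port v p).2 (hcenter v).symm).symm
    · have lower {p} (hp : N.id (center (N.port v p)) = N.id (center v) ∧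
          G.dist (N.port v p) (center (N.port v p)) < G.dist v (center v)) :
          (N.port v p : V) ∈ {u | G.Adj v u ∧ G.dist (center v) u < G.dist (center v) v} := by
        refine ⟨(N.port v p).2, ?_⟩
        rw [G.dist_comm, G.dist_comm (u := center v)]
        simpa only [N.id_injective hp.1] using hp.2
      exact subsingleton_adj_dist_lt hG (hcenter v).symm (lower hp) (lower hp')
  complete {V G} N ℓ h := by
    refine isAcyclic_of_depth (fun v => (ℓ v).2) (fun v u huv => ?_) fun v u hu u' hu' => ?_
    · obtain ⟨p, rfl⟩ := N.exists_port huv.1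
      exact (h v).1 p huv.2.symm
    · obtain ⟨p, rfl⟩ := N.exists_port hu.1.1
      obtain ⟨p', rfl⟩ := N.exists_port hu'.1.1
      rw [(h v).2 ⟨hu.1.2.symm, hu.2⟩ ⟨hu'.1.2.symm, hu'.2⟩]

end Certificates

section Probability

variable {Ω : Type*}

/-- The probability of an event when all outcomes are equally likely. -/
noncomputable def prob (S : Set Ω) : ℝ := S.ncard / Nat.card Ω

theorem prob_eq_expect [Fintype Ω] (S : Set Ω) : prob S = 𝔼 ω, S.indicator 1 ω := by
  classical
  rw [prob, Fintype.expect_eq_sum_div_card, sum_indicator_eq_sum_filter, Nat.card_eq_fintype_card,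
    Set.ncard_eq_toFinset_card', Set.filter_mem_univ_eq_toFinset]
  simp

theorem prob_nonneg (S : Set Ω) : 0 ≤ prob S := by
  unfold prob
  positivity

theorem prob_mono [Finite Ω] {S T : Set Ω} (h : S ⊆ T) : prob S ≤ prob T := by
  unfold prob
  gcongr
  exact T.toFinite

theorem prob_univ [Finite Ω] [Nonempty Ω] : prob (Set.univ : Set Ω) = 1 := by
  rw [prob, Set.ncard_univ, div_self (Nat.cast_ne_zero.2 Nat.card_pos.ne')]

theorem prob_compl [Finite Ω] [Nonempty Ω] (S : Set Ω) : prob Sᶜ = 1 - prob S := by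
  rw [eq_sub_iff_add_eq', ← prob_univ (Ω := Ω), prob, prob, prob, ← add_div, ← Nat.cast_add,
    Set.ncard_add_ncard_compl, Set.ncard_univ]

theorem prob_preimage_equiv {Ω' : Type*} (e : Ω' ≃ Ω) (S : Set Ω) : prob (e ⁻¹' S) = prob S := by
  rw [prob, prob, Set.ncard_preimage_of_injective_subset_range e.injective (by simp),
    Nat.card_congr e]

variable {ι : Type*} [Fintype ι]

theorem sum_prob_eq_expect_ncard [Fintype Ω] (S : ι → Set Ω) :
    ∑ i, prob (S i) = 𝔼 ω, ({i | ω ∈ S i}.ncard : ℝ) := by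
  classical
  simp only [prob_eq_expect]
  rw [← expect_sum_comm]
  refine expect_congr rfl fun ω _ => ?_
  rw [Set.ncard_eq_toFinset_card', Set.toFinset_ofPred, card_filter]
  push_cast
  rfl

theorem one_le_sum_prob [Finite Ω] [Nonempty Ω] {S : ι → Set Ω} (h : ∀ ω, ∃ i, ω ∈ S i) :
    1 ≤ ∑ i, prob (S i) := by
  cases nonempty_fintype Ω
  rw [sum_prob_eq_expect_ncard]
  refine le_expect univ_nonempty fun ω _ => ?_
  exact_mod_cast (Set.ncard_pos (Set.toFinite _)).2 (h ω)

theorem sum_prob_le_prob [Finite Ω] {S : ι → Set Ω}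
    (h : ∀ ω, {i | ω ∈ S i}.Subsingleton) : ∑ i, prob (S i) ≤ prob {ω | ∃ i, ω ∈ S i} := by
  cases nonempty_fintype Ω
  rw [sum_prob_eq_expect_ncard, prob_eq_expect]
  refine expect_le_expect fun ω _ => ?_
  by_cases hω : ω ∈ {ω | ∃ i, ω ∈ S i}
  · rw [Set.indicator_of_mem hω, Pi.one_apply]
    exact_mod_cast Set.ncard_le_one_iff_subsingleton.2 (h ω)
  · rw [Set.indicator_of_notMem hω, Nat.cast_nonpos, Set.ncard_eq_zero]
    exact Set.eq_empty_of_forall_notMem fun i hi => hω ⟨i, hi⟩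

end Probability

section Resampling

variable {V Ω : Type*} [Fintype V] [DecidableEq V] [Fintype Ω] [Nonempty Ω]

theorem expect_expect_update (w : V) (f : (V → Ω) → ℝ) :
    𝔼 ω, 𝔼 c, f (Function.update ω w c) = 𝔼 ω, f ω := by
  let swap (x : (V → Ω) × Ω) : (V → Ω) × Ω := (Function.update x.1 w x.2, x.1 w)
  have swap_involutive : Function.Involutive swap := fun x => by simp [swap]
  calc 𝔼 ω, 𝔼 c, f (Function.update ω w c)
      = 𝔼 x : (V → Ω) × Ω, f (Function.update x.1 w x.2) := by
        rw [← expect_product', univ_product_univ]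
    _ = 𝔼 x : (V → Ω) × Ω, f x.1 :=
        Fintype.expect_equiv swap_involutive.toPerm _ _ fun _ => rfl
    _ = 𝔼 ω, f ω := by
        rw [← univ_product_univ, expect_product]
        simp only [Fintype.expect_const]

theorem expect_prob_update (w : V) (E : Set (V → Ω)) :
    𝔼 ω, prob {c | Function.update ω w c ∈ E} = prob E := by
  rw [prob_eq_expect E, ← expect_expect_update w (E.indicator 1)]
  simp only [prob_eq_expect]
  rfl

end Resampling

section Geometric

/-- The random variable `r` has the geometric distribution with ratio `q`, truncated at `R`. -/
structure IsTruncatedGeometric {Ω : Type*} (r : Ω → ℕ) (R : ℕ) (q : ℝ) : Prop where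
  nonneg : 0 ≤ q
  le_one : q ≤ 1
  le (c : Ω) : r c ≤ R
  prob_ge {d : ℕ} : d ≤ R → prob {c | d ≤ r c} = q ^ d

variable {Ω : Type*} [Finite Ω] {r : Ω → ℕ} {R : ℕ} {q : ℝ}

/-- The geometric distribution is memoryless: the only loss is due to the truncation. -/
theorem IsTruncatedGeometric.mul_prob_le (hr : IsTruncatedGeometric r R q) {U : Set ℤ}
    (hU : IsUpperSet U) (d : ℕ) :
    q * prob {c | (r c : ℤ) - d ∈ U} ≤ prob {c | (r c : ℤ) - d - 1 ∈ U} + q ^ R := by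
  classical
  by_cases hne : ∃ n : ℕ, (n : ℤ) - d ∈ U
  · let n := Nat.find hne
    have mem_iff (m : ℕ) : (m : ℤ) - d ∈ U ↔ n ≤ m :=
      ⟨Nat.find_min' hne, fun h => hU (by omega) (Nat.find_spec hne)⟩
    simp only [mem_iff]
    rcases lt_or_ge n R with hn | hn
    · calc q * prob {c | n ≤ r c} = prob {c | n + 1 ≤ r c} := by
            rw [hr.prob_ge hn.le, hr.prob_ge hn, pow_succ']
        _ ≤ prob {c | (r c : ℤ) - d - 1 ∈ U} := prob_mono fun c hc => by
            have hc : n + 1 ≤ r c := hc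
            exact hU (by omega) ((mem_iff n).2 le_rfl)
        _ ≤ _ := le_add_of_nonneg_right (pow_nonneg hr.nonneg R)
    · calc q * prob {c | n ≤ r c} ≤ prob {c | n ≤ r c} :=
            mul_le_of_le_one_left (prob_nonneg _) hr.le_one
        _ ≤ prob {c | R ≤ r c} := prob_mono fun c hc => hn.trans hc
        _ = q ^ R := hr.prob_ge le_rfl
        _ ≤ _ := le_add_of_nonneg_left (prob_nonneg _)
  · push Not at hne
    simp only [hne, Set.ofPred_false, prob, Set.ncard_empty, Nat.cast_zero, zero_div, mul_zero]
    have := hr.nonneg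
    positivity

end Geometric

section LeadByOne

variable {V Ω α : Type*} [LinearOrder α] {s : Set V} {id : V → α} {r : Ω → ℕ} {R : ℕ} {q : ℝ}

theorem isUpperSet_leads_update [DecidableEq V] (s : Set V) (id : V → α) (a : V → ℤ) (w : V) :
    IsUpperSet {m | Leads s id (Function.update a w m) w} := fun m m' hm h =>
  Leads.mono h (by simpa using hm) fun x _ hx => by simp [hx]

variable [DecidableEq V] [Finite Ω] [Nonempty Ω]

theorem IsTruncatedGeometric.mul_prob_leads_le [Finite V] (hr : IsTruncatedGeometric r R q)
    (s : Set V) (id : V → α) (d : V → ℕ) (w : V) :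
    q * prob {ω : V → Ω | Leads s id (fun x => r (ω x) - d x) w} ≤
      prob {ω : V → Ω | Leads s id
        (Function.update (fun x => (r (ω x) : ℤ) - d x) w (r (ω w) - d w - 1)) w} + q ^ R := by
  cases nonempty_fintype V
  cases nonempty_fintype Ω
  have update_score (ω : V → Ω) (c : Ω) : (fun x => (r (Function.update ω w c x) : ℤ) - d x) =
      Function.update (fun x => (r (ω x) : ℤ) - d x) w (r c - d w) := by
    ext x
    obtain rfl | hx := eq_or_ne x w <;> simp [*]
  rw [← expect_prob_update w, ← expect_prob_update w, mul_expect,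
    ← Fintype.expect_const (ι := V → Ω) (q ^ R), ← expect_add_distrib]
  refine expect_le_expect fun ω _ => ?_
  simp only [Set.mem_ofPred_eq, update_score, Function.update_self, Function.update_idem]
  exact hr.mul_prob_le (isUpperSet_leads_update s id _ w) (d w)

/-- Some candidate leads; as it still leads when its score is lowered with conditional probability
almost `q`, summing over the candidates gives the bound. -/
theorem IsTruncatedGeometric.le_prob_exists_leads [Fintype V] (hr : IsTruncatedGeometric r R q)
    (hid : id.Injective) (hs : s.Nonempty) (d : V → ℕ) :
    q - Fintype.card V * q ^ R ≤ prob {ω : V → Ω | ∃ w, Leads s id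
      (Function.update (fun x => (r (ω x) : ℤ) - d x) w (r (ω w) - d w - 1)) w} := by
  cases nonempty_fintype Ω
  let a (ω : V → Ω) (x : V) : ℤ := r (ω x) - d x
  let E (w : V) : Set (V → Ω) := {ω | Leads s id (a ω) w}
  let E' (w : V) : Set (V → Ω) := {ω | Leads s id (Function.update (a ω) w (a ω w - 1)) w}
  have E'_subset (w : V) : E' w ⊆ E w := fun ω h =>
    Leads.mono h (by simp) fun x _ hx => by simp [hx]
  have one_le : 1 ≤ ∑ w, prob (E w) :=
    one_le_sum_prob fun ω => exists_leads s.toFinite hs id (a ω)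
  have sum_le : ∑ w, prob (E' w) ≤ prob {ω | ∃ w, ω ∈ E' w} :=
    sum_prob_le_prob fun ω w hw w' hw' => (E'_subset w hw).eq hid (E'_subset w' hw')
  have shift : ∑ w, q * prob (E w) ≤ ∑ w, (prob (E' w) + q ^ R) :=
    sum_le_sum fun w _ => hr.mul_prob_leads_le s id d w
  rw [← mul_sum, sum_add_distrib, sum_const, card_univ, nsmul_eq_mul] at shift
  have := le_mul_of_one_le_right hr.nonneg one_le
  exact sub_le_iff_le_add.2 (this.trans (shift.trans (add_le_add_left sum_le _)))

end LeadByOne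

section Blocks

theorem prob_pi {ι : Type*} [Fintype ι] {Ω : ι → Type*} (S : ∀ i, Set (Ω i)) :
    prob {f : ∀ i, Ω i | ∀ i, f i ∈ S i} = ∏ i, prob (S i) := by
  have ncard_eq : {f : ∀ i, Ω i | ∀ i, f i ∈ S i}.ncard = ∏ i, (S i).ncard := by
    simp only [← Nat.card_coe_set_eq, ← Nat.card_pi]
    exact Nat.card_congr (Equiv.subtypePiEquivPi (p := fun i x => x ∈ S i))
  simp only [prob, ncard_eq, Nat.card_pi, Nat.cast_prod, prod_div_distrib]

/-- The number of leading blocks with a `true`, when the coins are divided into `R` blocks of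
`j` coins. -/
noncomputable def blockRadius (R j : ℕ) (c : Fin (R * j) → Bool) : ℕ :=
  Nat.findGreatest (fun d => ∀ a : Fin R, a < d → ∃ b, c (finProdFinEquiv (a, b)) = true) R

theorem le_blockRadius_iff {R j d : ℕ} (hd : d ≤ R) (c : Fin (R * j) → Bool) :
    d ≤ blockRadius R j c ↔ ∀ a : Fin R, a < d → ∃ b, c (finProdFinEquiv (a, b)) = true := by
  refine ⟨fun h a ha => ?_, fun h => Nat.le_findGreatest hd h⟩
  have spec : ∀ a : Fin R, a < blockRadius R j c → ∃ b, c (finProdFinEquiv (a, b)) = true :=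
    Nat.findGreatest_spec (P := fun d => ∀ a : Fin R, a < d → _) R.zero_le (by simp)
  exact spec a (ha.trans_le h)

theorem prob_exists_eq_true (j : ℕ) :
    prob {c : Fin j → Bool | ∃ b, c b = true} = 1 - 1 / 2 ^ j := by
  have heq : {c : Fin j → Bool | ∃ b, c b = true} = {fun _ => false}ᶜ := by
    ext c
    simp [funext_iff]
  rw [heq, prob_compl, prob, Set.ncard_singleton]
  simp

theorem isTruncatedGeometric_blockRadius (R j : ℕ) :
    IsTruncatedGeometric (blockRadius R j) R (1 - 1 / 2 ^ j) where
  nonneg := sub_nonneg.2 (div_le_one_of_le₀ (one_le_pow₀ one_le_two) (by positivity))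
  le_one := sub_le_self _ (by positivity)
  le c := Nat.findGreatest_le R
  prob_ge {d} hd := by
    let blocks : (Fin (R * j) → Bool) ≃ (Fin R → Fin j → Bool) :=
      (finProdFinEquiv.symm.arrowCongr (.refl Bool)).trans (.curry _ _ _)
    let S (a : Fin R) : Set (Fin j → Bool) := if a < d then {x | ∃ b, x b = true} else .univ
    have heq : {c | d ≤ blockRadius R j c} = blocks ⁻¹' {f | ∀ a, f a ∈ S a} := by
      ext c
      refine (le_blockRadius_iff hd c).trans (forall_congr' fun a => ?_)
      by_cases ha : (a : ℕ) < d <;> simp [S, ha, blocks]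
    have prob_S (a : Fin R) : prob (S a) = if (a : ℕ) < d then 1 - 1 / 2 ^ j else 1 := by
      by_cases ha : (a : ℕ) < d <;> simp only [S, ha, if_true, if_false, prob_exists_eq_true,
        prob_univ]
    rw [heq, prob_preimage_equiv, prob_pi, prod_congr rfl fun a _ => prob_S a, prod_ite,
      prod_const, prod_const_one, mul_one, Fin.card_filter_val_lt, min_eq_right hd]

end Blocks

section Far

variable {V : Type u} {G : SimpleGraph V} {P : SimpleGraph V → Prop} {ε : ℝ}

theorem IsFar.ne_bot (h : IsFar P ε G) (hP : P ⊥) : G ≠ ⊥ :=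
  fun hG => h.1 (hG ▸ hP)

theorem IsFar.ncard_edgeSet_pos [Finite V] (h : IsFar P ε G) (hP : P ⊥) :
    0 < (G.edgeSet.ncard : ℝ) := by
  rw [Nat.cast_pos, Set.ncard_pos]
  exact SimpleGraph.edgeSet_nonempty.2 (h.ne_bot hP)

theorem IsFar.le_one [Finite V] (h : IsFar P ε G) (hP : P ⊥) : ε ≤ 1 := by
  have := h.2 ⊥ hP
  rw [SimpleGraph.edgeSet_bot, ← Set.bot_eq_empty, symmDiff_bot] at this
  exact le_of_mul_le_mul_right (by linarith) (h.ncard_edgeSet_pos hP)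

end Far

section EdgeCuts

variable {V : Type u} {G : SimpleGraph V} {Ω : Type*} [Finite Ω]

theorem le_prob_clusterGraph_adj [Fintype V] [Nonempty Ω] (N : Network G) {r : Ω → ℕ} {R : ℕ}
    {q : ℝ} (hr : IsTruncatedGeometric r R q) {u v : V} (h : G.Adj u v) :
    q - Fintype.card V * q ^ R ≤ prob {ω : V → Ω |
      (clusterGraph G fun x => (clusterLabel N R (fun x => r (ω x)) x).1).Adj u v} := by
  classical
  have hne : {x | G.Reachable u x}.Nonempty := ⟨u, SimpleGraph.Reachable.refl u⟩
  refine (hr.le_prob_exists_leads N.id_injective hne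
    fun x => min (G.dist u x) (G.dist v x)).trans (prob_mono fun ω hω => ?_)
  obtain ⟨w, hw⟩ := hω
  let ρ (x : V) : ℕ := r (ω x)
  have hρ (x : V) : ρ x ≤ R := hr.le (ω x)
  obtain ⟨hu, hv⟩ : IsCenter G N.id ρ u w ∧ IsCenter G N.id ρ v w := isCenter_of_adj h hw
  exact ⟨h, (congrArg Prod.fst (clusterLabel_eq N hρ hu)).trans
    (congrArg Prod.fst (clusterLabel_eq N hρ hv)).symm⟩

/-- If `H ω` has the property `P`, then at least `ε |E(G)|` edges are cut (Markov's inequality). -/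
theorem IsFar.mul_prob_le [Finite V] {P : SimpleGraph V → Prop} {ε η : ℝ} (hG : IsFar P ε G)
    (hP : P ⊥) {H : Ω → SimpleGraph V} (hle : ∀ ω, H ω ≤ G)
    (hη : ∀ u v, G.Adj u v → prob {ω | ¬(H ω).Adj u v} ≤ η) : ε * prob {ω | P (H ω)} ≤ η := by
  classical
  cases nonempty_fintype V
  cases nonempty_fintype Ω
  let cut (e : G.edgeSet) : Set Ω := {ω | (e : Sym2 V) ∉ (H ω).edgeSet}
  have prob_cut_le (e : G.edgeSet) : prob (cut e) ≤ η := by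
    obtain ⟨e, he⟩ := e
    induction e with | h u v => exact hη u v he
  have far (ω : Ω) (hω : P (H ω)) : ε * G.edgeSet.ncard ≤ {e | ω ∈ cut e}.ncard := by
    have := hG.2 (H ω) hω
    rw [symmDiff_of_ge (SimpleGraph.edgeSet_mono (hle ω))] at this
    rw [← Set.ncard_image_of_injective _ Subtype.val_injective]
    convert this using 3
    ext e
    simp [cut, and_comm]
  refine le_of_mul_le_mul_right ?_ (hG.ncard_edgeSet_pos hP)
  calc ε * prob {ω | P (H ω)} * G.edgeSet.ncard
      = 𝔼 ω, ε * G.edgeSet.ncard * {ω | P (H ω)}.indicator 1 ω := by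
        rw [← mul_expect, ← prob_eq_expect]
        ring
    _ ≤ 𝔼 ω, ({e | ω ∈ cut e}.ncard : ℝ) := by
        refine expect_le_expect fun ω _ => ?_
        by_cases hω : P (H ω)
        · simpa [hω] using far ω hω
        · simp [hω]
    _ = ∑ e, prob (cut e) := (sum_prob_eq_expect_ncard cut).symm
    _ ≤ ∑ _e : G.edgeSet, η := sum_le_sum fun e _ => prob_cut_le e
    _ = η * G.edgeSet.ncard := by
        rw [sum_const, card_univ, nsmul_eq_mul, mul_comm, Set.ncard_eq_toFinset_card',
          Set.toFinset_card]

end EdgeCuts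

section Tester

variable {m B R : ℕ}

/-- The program that clusters the network with the strengths `r`, and then applies the local check
`ok` to the labels. -/
noncomputable def clusterTester (encode : Token → Message B) (decode : Message B → Token)
    (r : (Fin m → Bool) → ℕ) (R : ℕ) (ok : LocalCheck) : Program :=
  gossipProgram encode decode hop (fun id c => token (r c) id 0)
    (fun d x y => ok d (label x) fun p => label (y p)) R

/-- On the networks with `n` processors whose IDs are smaller than `K`, the program `A` is a
one-sided `ε`-tester for `P`. -/
def TestsAt (P : ∀ V : Type u, SimpleGraph V → Prop) (n K : ℕ) (ε : ℝ) (A : Program) : Prop :=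
  ∀ (V : Type u) [Fintype V] (G : SimpleGraph V) (N : Network G), Fintype.card V = n →
    (∀ v, N.id v < K) →
      (P V G → ∀ (ω : A.Coins V) (v : V), A.result N ω v = true) ∧
      (IsFar (P V) ε G → 2 / 3 ≤ A.prob {ω : A.Coins V | ∃ v, A.result N ω v = false})

variable {V : Type u} {G : SimpleGraph V} {N : Network G} {encode : Token → Message B}
  {decode : Message B → Token} {K : ℕ} {r : (Fin m → Bool) → ℕ} {ok : LocalCheck}
  {P : ∀ V : Type u, SimpleGraph V → Prop}

theorem clusterTester_result_eq_true_iff (hdecode : Set.LeftInvOn decode encode (tokens K R))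
    (hr : ∀ c, r c ≤ R) (hid : ∀ v, N.id v < K) (ω : V → Fin m → Bool) (v : V) :
    (clusterTester encode decode r R ok).result N ω v = true ↔
      N.Passes ok (clusterLabel N R fun v => r (ω v)) v :=
  gossipProgram_result_eq_true_iff N
    (fun t v => hdecode (flood_mem_tokens N (ρ := fun v => r (ω v)) (fun _ => hr _) hid t v)) v

theorem IsCertificate.passes_clusterLabel (hP : IsCertificate P ok) (hG : P V G) {ρ : V → ℕ}
    (hρ : ∀ v, ρ v ≤ R) (v : V) : N.Passes ok (clusterLabel N R ρ) v := by
  choose center hcenter hlabel using exists_isCenter N hρ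
  rw [funext hlabel]
  exact hP.sound N hG (fun v => (hcenter v).1) v

theorem IsCertificate.le_prob_not_passes [Fintype V] (hP : IsCertificate P ok) {q ε : ℝ}
    (hr : IsTruncatedGeometric r R q) (hε : 0 < ε)
    (hq : 3 * (1 - q + Fintype.card V * q ^ R) ≤ ε) (hG : IsFar (P V) ε G) :
    2 / 3 ≤ prob {ω : V → Fin m → Bool |
      ∃ v, ¬N.Passes ok (clusterLabel N R fun v => r (ω v)) v} := by
  let H (ω : V → Fin m → Bool) : SimpleGraph V :=
    clusterGraph G fun x => (clusterLabel N R (fun v => r (ω v)) x).1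
  have prob_cut_le (u v : V) (h : G.Adj u v) : prob {ω | ¬(H ω).Adj u v} ≤ ε / 3 := by
    change prob {ω | (H ω).Adj u v}ᶜ ≤ ε / 3
    rw [prob_compl]
    linarith [le_prob_clusterGraph_adj N hr h]
  have prob_le : prob {ω | P V (H ω)} ≤ 1 / 3 := by
    have := hG.mul_prob_le (hP.bot V) (fun ω => clusterGraph_le _) prob_cut_le
    exact le_of_mul_le_mul_left (by linarith) hε
  calc (2 / 3 : ℝ) ≤ prob {ω | P V (H ω)}ᶜ := by
        rw [prob_compl]
        linarith
    _ ≤ _ := prob_mono fun ω hω => not_forall.1 fun h => hω (hP.complete N h)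

theorem IsCertificate.testsAt_clusterTester (hP : IsCertificate P ok)
    (hdecode : Set.LeftInvOn decode encode (tokens K R)) {q ε : ℝ} {n : ℕ}
    (hr : IsTruncatedGeometric r R q) (hε : 0 < ε) (hq : 3 * (1 - q + n * q ^ R) ≤ ε) :
    TestsAt P n K ε (clusterTester encode decode r R ok) := by
  intro V _ G N hn hid
  have result_iff := clusterTester_result_eq_true_iff (ok := ok) hdecode hr.le hid
  refine ⟨fun hG ω v => (result_iff ω v).2 (hP.passes_clusterLabel hG (fun v => hr.le (ω v)) v),
    fun hfar => (hP.le_prob_not_passes (N := N) hr hε (hn ▸ hq) hfar).trans_eq ?_⟩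
  refine congrArg prob (Set.ext fun ω => exists_congr fun v => ?_)
  rw [← result_iff, Bool.not_eq_true]

end Tester

section Parameters

variable {n j : ℕ} {ε : ℝ}

theorem one_sub_pow_two_pow_mul_le (j m : ℕ) : (1 - 1 / 2 ^ j : ℝ) ^ (2 ^ j * m) ≤ 1 / 2 ^ m := by
  have one_sub_nonneg : (0 : ℝ) ≤ 1 - 1 / 2 ^ j := (isTruncatedGeometric_blockRadius 0 j).nonneg
  have h : (1 - 1 / 2 ^ j : ℝ) ^ 2 ^ j ≤ 1 / 2 := by
    have one_le : (1 : ℝ) ≤ (2 ^ j : ℕ) := by exact_mod_cast Nat.one_le_two_pow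
    have := Real.one_sub_div_pow_le_exp_neg one_le
    push_cast at this
    refine this.trans ?_
    rw [Real.exp_neg, ← one_div]
    exact one_div_le_one_div_of_le two_pos (by linarith [Real.add_one_le_exp 1])
  calc (1 - 1 / 2 ^ j : ℝ) ^ (2 ^ j * m) = ((1 - 1 / 2 ^ j) ^ 2 ^ j) ^ m := pow_mul _ _ _
    _ ≤ (1 / 2) ^ m := by gcongr
    _ = 1 / 2 ^ m := one_div_pow 2 m

theorem size_le_four_mul_log (hn : 2 ≤ n) : (n.size : ℝ) ≤ 4 * Real.log n := by
  have two_le : 2 ≤ n.size := Nat.lt_size.2 (by simpa using hn)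
  have pow_le : (2 : ℝ) ^ (n.size - 1) ≤ n := by
    exact_mod_cast Nat.lt_size.1 (show n.size - 1 < n.size by omega)
  have log_le := Real.log_le_log (by positivity) pow_le
  rw [Real.log_pow, Nat.cast_sub (by omega)] at log_le
  have : (2 : ℝ) ≤ n.size := by exact_mod_cast two_le
  push_cast at log_le
  nlinarith [Real.log_two_gt_d9]

theorem exists_two_pow_mem_Icc {x : ℝ} (hx : 1 ≤ x) : ∃ j : ℕ, (2 : ℝ) ^ j ∈ Set.Icc x (2 * x) := by
  obtain ⟨j, hj, hj'⟩ := exists_nat_pow_near hx one_lt_two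
  exact ⟨j + 1, hj'.le, by rw [pow_succ']; gcongr⟩

/-- The number of rounds of flooding when the strengths have the ratio `1 - 1 / 2 ^ j`. For
`j ≤ 6 * n.size` it makes the truncation error `n * (1 - 1 / 2 ^ j) ^ floodRounds n j` at most
`1 / 2 ^ j`. -/
def floodRounds (n j : ℕ) : ℕ := 2 ^ j * (7 * n.size)

theorem le_six_mul_size (hn : 0 < n) (hj : (2 : ℝ) ^ j ≤ 12 * n ^ 2) : j ≤ 6 * n.size := by
  have size_pos : 0 < n.size := Nat.size_pos.2 hn
  refine (Nat.pow_le_pow_iff_right one_lt_two).1 ?_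
  calc 2 ^ j ≤ 12 * n ^ 2 := by exact_mod_cast hj
    _ ≤ 2 ^ 4 * (2 ^ n.size) ^ 2 := by
      gcongr
      · norm_num
      · exact n.lt_size_self.le
    _ = 2 ^ (4 + n.size * 2) := by rw [← pow_mul, ← pow_add]
    _ ≤ 2 ^ (6 * n.size) := Nat.pow_le_pow_right two_pos (by omega)

theorem floodRounds_succ_le (hn : 0 < n) : floodRounds n j + 1 ≤ 8 * n.size * 2 ^ j := by
  have size_pos : 0 < n.size := Nat.size_pos.2 hn
  have := Nat.mul_pos size_pos (Nat.two_pow_pos j)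
  rw [floodRounds]
  linarith

theorem pow_mul_floodRounds_sq_le (hn : 0 < n) (hj : j ≤ 6 * n.size) (k : ℕ) :
    n ^ k * (floodRounds n j + 1) ^ 2 ≤ 2 ^ ((k + 20) * n.size) := by
  have size_pos : 0 < n.size := Nat.size_pos.2 hn
  have succ_le : floodRounds n j + 1 ≤ 2 ^ (10 * n.size) :=
    calc floodRounds n j + 1 ≤ 8 * n.size * 2 ^ j := floodRounds_succ_le hn
      _ ≤ 2 ^ 3 * 2 ^ n.size * 2 ^ (6 * n.size) := by
        gcongr
        · norm_num
        · exact Nat.lt_two_pow_self.le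
        · exact one_le_two
      _ = 2 ^ (3 + n.size + 6 * n.size) := by rw [pow_add, pow_add]
      _ ≤ 2 ^ (10 * n.size) := Nat.pow_le_pow_right two_pos (by omega)
  calc n ^ k * (floodRounds n j + 1) ^ 2 ≤ (2 ^ n.size) ^ k * (2 ^ (10 * n.size)) ^ 2 := by
        gcongr
        exact n.lt_size_self.le
    _ = 2 ^ ((k + 20) * n.size) := by
        rw [← pow_mul, ← pow_mul, ← pow_add]
        ring_nf

theorem mul_pow_floodRounds_le (hj : j ≤ 6 * n.size) :
    n * (1 - 1 / 2 ^ j : ℝ) ^ floodRounds n j ≤ 1 / 2 ^ j :=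
  calc n * (1 - 1 / 2 ^ j : ℝ) ^ floodRounds n j ≤ 2 ^ n.size * (1 / 2 ^ (7 * n.size)) := by
        gcongr
        · exact pow_nonneg (isTruncatedGeometric_blockRadius 0 j).nonneg _
        · exact_mod_cast n.lt_size_self.le
        · exact one_sub_pow_two_pow_mul_le j (7 * n.size)
    _ = 1 / 2 ^ (6 * n.size) := by
        rw [show 7 * n.size = n.size + 6 * n.size by ring, pow_add]
        field_simp
    _ ≤ 1 / 2 ^ j := by
        gcongr
        exact one_le_two

theorem IsCertificate.exists_testsAt {P : ∀ V : Type u, SimpleGraph V → Prop} {ok : LocalCheck}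
    (hP : IsCertificate P ok) (hn : 2 ≤ n) (hε : 1 / (n : ℝ) ^ 2 ≤ ε) (hε' : ε ≤ 1) (k : ℕ) :
    ∃ A : Program, (A.bandwidth : ℝ) ≤ 4 * (k + 20) * Real.log n ∧
      (A.rounds : ℝ) ≤ 384 * (Real.log n / ε) ∧ TestsAt P n (n ^ k) ε A := by
  have n_pos : 0 < n := by omega
  have ε_pos : 0 < ε := lt_of_lt_of_le (by positivity) hε
  have size_le := size_le_four_mul_log hn
  obtain ⟨j, le_two_pow, two_pow_le⟩ := exists_two_pow_mem_Icc (x := 6 / ε)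
    ((one_le_div ε_pos).2 (by linarith))
  have j_le : j ≤ 6 * n.size := le_six_mul_size n_pos <|
    calc (2 : ℝ) ^ j ≤ 2 * (6 / ε) := two_pow_le
      _ ≤ 2 * (6 / (1 / n ^ 2)) := by gcongr
      _ = 12 * n ^ 2 := by
        field_simp
        norm_num
  obtain ⟨encode, decode, hdecode⟩ := exists_message_encoding
    ((card_tokens_le _ _).trans (pow_mul_floodRounds_sq_le n_pos j_le k))
  refine ⟨clusterTester encode decode (blockRadius _ j) (floodRounds n j) ok, ?_, ?_,
    hP.testsAt_clusterTester hdecode (isTruncatedGeometric_blockRadius _ j) ε_pos ?_⟩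
  · change (((k + 20) * n.size : ℕ) : ℝ) ≤ _
    push_cast
    nlinarith
  · calc ((floodRounds n j + 1 : ℕ) : ℝ) ≤ 8 * n.size * 2 ^ j := by
          exact_mod_cast floodRounds_succ_le n_pos
      _ ≤ 8 * (4 * Real.log n) * (2 * (6 / ε)) := by gcongr
      _ = 384 * (Real.log n / ε) := by ring
  · have := mul_pow_floodRounds_le j_le
    have : 6 * (1 / 2 ^ j) ≤ ε := by
      rw [div_le_iff₀ ε_pos] at le_two_pow
      rw [mul_one_div, div_le_iff₀ (by positivity)]
      linarith
    linarith

end Parameters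

section SmallParameters

variable {V : Type u} [Fintype V] {G : SimpleGraph V} {P : SimpleGraph V → Prop} {ε : ℝ}

theorem ncard_edgeSet_le (G : SimpleGraph V) : G.edgeSet.ncard ≤ Fintype.card V ^ 2 := by
  classical
  rw [← SimpleGraph.coe_edgeFinset, Set.ncard_coe_finset]
  exact SimpleGraph.card_edgeFinset_le_card_choose_two.trans (Nat.choose_le_pow _ _)

/-- A graph without `P` differs from every graph with `P` in at least one edge. -/
theorem IsFar.max_one_div_card_sq (h : IsFar P ε G) :
    IsFar P (max ε (1 / (Fintype.card V : ℝ) ^ 2)) G := by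
  refine ⟨h.1, fun H hH => ?_⟩
  rw [max_mul_of_nonneg _ _ (Nat.cast_nonneg _)]
  refine max_le (h.2 H hH) ?_
  have one_le : 1 ≤ (symmDiff G.edgeSet H.edgeSet).ncard := by
    rw [Nat.one_le_iff_ne_zero, Ne, Set.ncard_eq_zero, ← Set.bot_eq_empty, symmDiff_eq_bot]
    exact fun heq => h.1 (SimpleGraph.edgeSet_injective heq ▸ hH)
  calc 1 / (Fintype.card V : ℝ) ^ 2 * G.edgeSet.ncard ≤ 1 := by
        rw [one_div_mul_eq_div]
        exact div_le_one_of_le₀ (by exact_mod_cast ncard_edgeSet_le G) (by positivity)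
    _ ≤ _ := by exact_mod_cast one_le

theorem IsFar.two_le_card (h : IsFar P ε G) (hP : P ⊥) : 2 ≤ Fintype.card V := by
  by_contra! hlt
  have : Subsingleton V := Fintype.card_le_one_iff_subsingleton.1 (by omega)
  exact h.ne_bot hP (Subsingleton.elim _ _)

end SmallParameters

section MainTheorem

variable {P : ∀ V : Type u, SimpleGraph V → Prop} {n K : ℕ} {ε : ℝ} {A : Program}

theorem TestsAt.of_max (h : TestsAt P n K (max ε (1 / (n : ℝ) ^ 2)) A) : TestsAt P n K ε A :=
  fun V _ G N hn hid =>
    ⟨(h V G N hn hid).1, fun hfar => (h V G N hn hid).2 (hn ▸ hfar.max_one_div_card_sq)⟩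

/-- The program that accepts at once. -/
def acceptProgram : Program where
  bandwidth := 0
  rounds := 0
  coins := 0
  State := Unit
  init _ _ _ := ()
  send _ _ := Message.empty 0
  receive s _ := s
  output _ := true

theorem testsAt_acceptProgram (hP : ∀ V, P V ⊥) (h : 2 ≤ n → 1 < ε) :
    TestsAt P n K ε acceptProgram := fun V _ _ _ hn _ =>
  ⟨fun _ _ _ => rfl, fun hfar =>
    ((hfar.le_one (hP V)).not_gt (h (hn ▸ hfar.two_le_card (hP V)))).elim⟩

theorem IsCertificate.hasLogTester {ok : LocalCheck} (hP : IsCertificate P ok) :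
    HasLogTester P := by
  refine ⟨384, fun k => ⟨4 * (k + 20), fun ε hε => ?_⟩⟩
  have exists_program (n : ℕ) : ∃ A : Program, (A.bandwidth : ℝ) ≤ 4 * (k + 20) * Real.log n ∧
      (A.rounds : ℝ) ≤ 384 * (Real.log n / ε) ∧ TestsAt P n (n ^ k) ε A := by
    by_cases h : 2 ≤ n ∧ ε ≤ 1
    · have inv_sq_le : 1 / (n : ℝ) ^ 2 ≤ 1 :=
        div_le_one_of_le₀ (by exact_mod_cast Nat.one_le_pow _ _ (by omega)) (by positivity)
      obtain ⟨A, hA, hA', htest⟩ :=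
        hP.exists_testsAt h.1 (le_max_right ε _) (max_le h.2 inv_sq_le) k
      refine ⟨A, hA, hA'.trans ?_, htest.of_max⟩
      gcongr
      exact le_max_left _ _
    · refine ⟨acceptProgram, ?_, ?_, testsAt_acceptProgram hP.bot (by simpa using h)⟩
      all_goals
        simp only [acceptProgram, Nat.cast_zero]
        positivity
  choose A bandwidth_le rounds_le testsAt using exists_program
  exact ⟨A, bandwidth_le, rounds_le, fun V _ G N hid => testsAt _ V G N rfl hid⟩

end MainTheorem

end Congest

theorem mainTheorem2 :
    Congest.HasLogTester.{u} (fun _ G => G.IsBipartite) ∧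
      Congest.HasLogTester.{u} (fun _ G => G.IsAcyclic) :=
  ⟨Congest.isCertificate_bipartiteCheck.hasLogTester,
    Congest.isCertificate_acyclicCheck.hasLogTester⟩
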